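/- Let $n,k$ be natural numbers. Matrix data $c=(A,B,C,D,L,Q,R)$, with $A,C,Q\in\mathbb R^{n\times n}$, $B,D\in\mathbb R^{n\times k}$, $L\in\mathbb R^{k\times n}$, $R\in\mathbb R^{k\times k}$, are called admissible if $\begin{pmatrix}Q&L'\\L&R\end{pmatrix}$ is symmetric positive semidefinite and $\ker R\cap\ker D=\{0\}$. The generalized Riccati differential equation (GRDE) with data $c$, possibly depending continuously on time, is the equation $$\dot P=\phi(P)=A'P+PA+C'PC+Q-(B'P+D'PC+L)'(R+D'PD)^{-1}(B'P+D'PC+L)$$ on positive definite $n\times n$ matrices; $M_s^t(G)$ denotes the value at time $t\ge s$ of its solution with value $G$ at time $s$, defined as long as this solution exists and stays positive definite. A symmetric gauge function is a convex function $\nu:\mathbb R^n\to\mathbb R$, positively homogeneous of degree one, such that $\nu(\lambda_1,\dots,\lambda_n)=\nu(|\lambda_{\sigma(1)}|,\dots,|\lambda_{\sigma(n)}|)$ for every $\lambda\in\mathbb R^n$ and every permutation $\sigma$. For a symmetric matrix $S$ with vector of eigenvalues $\lambda(S)$ put $\hat\nu(S)=\nu(\lambda(S))$, and for positive definite $P_1,P_2$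 put $d_\nu(P_1,P_2)=\hat\nu\big(\log(P_1^{-1/2}P_2P_1^{-1/2})\big)$. The flow is non-expansive in $d_\nu$ if $d_\nu(M_s^t(G_1),M_s^t(G_2))\le d_\nu(G_1,G_2)$ for all positive definite $G_1,G_2$ and all times $s\le t$ (in the time interval on which the data are given) for which both sides are defined. Theorem. For every symmetric gauge function $\nu$ on $\mathbb R^n$, the following are equivalent: (i) for every $T>0$ and all admissible data that depend continuously on $t\in[0,T]$, the flow of the GRDE on $[0,T]$ is non-expansive in $d_\nu$; (ii) for all constant admissible data, the flow of the GRDE on $[0,\infty)$ is non-expansive in $d_\nu$; (iii) $\nu$ is a scalar multiple of the sup-norm, i.e. there is $a\ge 0$ with $\nu(\lambda)=a\max_i|\lambda_i|$ for all $\lambda\in\mathbb R^n$. In particular, if $n\ge 2$, there are constant admissible data for which the flow of the GRDE is not non-expansive in the invariant Riemannian metric, i.e. in $d_\nu$ with $\nu(\lambda)=(\sum_i\lambda_i^2)^{1/2}$. -/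

import Mathlib

open Set

namespace GRDE

/-- A symmetric gauge function on `ℝⁿ`: a convex, positively homogeneous function of degree one
that is invariant under permutations and sign changes of the coordinates. -/
structure IsSymmetricGauge {n : ℕ} (ν : (Fin n → ℝ) → ℝ) : Prop where
  convex : ConvexOn ℝ univ ν
  pos_homogeneous : ∀ (r : ℝ) (x : Fin n → ℝ), 0 < r → ν (r • x) = r * ν x
  symmetric : ∀ (σ : Equiv.Perm (Fin n)) (x : Fin n → ℝ), ν x = ν (fun i => |x (σ i)|)

/-- The function `ν̂` on symmetric matrices, `ν̂ S = ν (λ S)`, where `λ S` is the vector of the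
eigenvalues of `S` counted with multiplicity (the value at a matrix that is not symmetric is
irrelevant). -/
noncomputable def spectralFn {n : ℕ} (ν : (Fin n → ℝ) → ℝ) (S : Matrix (Fin n) (Fin n) ℝ) : ℝ :=
  open Classical in if h : S.IsHermitian then ν h.eigenvalues else 0

/-- `P^{-1/2}`, through the continuous functional calculus of symmetric matrices. -/
noncomputable def invSqrt {n : ℕ} (P : Matrix (Fin n) (Fin n) ℝ) : Matrix (Fin n) (Fin n) ℝ :=
  (cfc Real.sqrt P)⁻¹

/-- The logarithm of a positive definite matrix. -/
noncomputable def matLog {n : ℕ} (P : Matrix (Fin n) (Fin n) ℝ) : Matrix (Fin n) (Fin n) ℝ :=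
  cfc Real.log P

/-- The invariant Finsler metric `d_ν(P, Q) = ν̂ (log (P^{-1/2} Q P^{-1/2}))` on positive definite
matrices. -/
noncomputable def finslerDist {n : ℕ} (ν : (Fin n → ℝ) → ℝ) (P Q : Matrix (Fin n) (Fin n) ℝ) : ℝ :=
  spectralFn ν (matLog (invSqrt P * Q * invSqrt P))

/-- The Euclidean norm on `ℝⁿ`; its metric `finslerDist euclideanGauge` is the invariant
Riemannian metric on positive definite matrices. -/
noncomputable def euclideanGauge {n : ℕ} (x : Fin n → ℝ) : ℝ :=
  Real.sqrt (∑ i, x i ^ 2)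

/-- The matrix data `(A, B, C, D, L, Q, R)` of a generalized Riccati differential equation with
state dimension `n` and control dimension `k`. -/
structure Coeffs (n k : ℕ) where
  A : Matrix (Fin n) (Fin n) ℝ
  B : Matrix (Fin n) (Fin k) ℝ
  C : Matrix (Fin n) (Fin n) ℝ
  D : Matrix (Fin n) (Fin k) ℝ
  L : Matrix (Fin k) (Fin n) ℝ
  Q : Matrix (Fin n) (Fin n) ℝ
  R : Matrix (Fin k) (Fin k) ℝ

/-- Admissible data: the block matrix `[Q, Lᵀ; L, R]` is (symmetric) positive semidefinite and
`ker R ∩ ker D = {0}`. -/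
def Coeffs.Admissible {n k : ℕ} (c : Coeffs n k) : Prop :=
  (Matrix.fromBlocks c.Q c.L.transpose c.L c.R).PosSemidef ∧
    ∀ u : Fin k → ℝ, c.R.mulVec u = 0 → c.D.mulVec u = 0 → u = 0

/-- The right-hand side of the generalized Riccati differential equation. -/
noncomputable def Coeffs.phi {n k : ℕ} (c : Coeffs n k) (P : Matrix (Fin n) (Fin n) ℝ) :
    Matrix (Fin n) (Fin n) ℝ :=
  c.A.transpose * P + P * c.A + c.C.transpose * P * c.C + c.Q -
    (c.B.transpose * P + c.D.transpose * P * c.C + c.L).transpose *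
      (c.R + c.D.transpose * P * c.D)⁻¹ *
      (c.B.transpose * P + c.D.transpose * P * c.C + c.L)

/-- Time-dependent data that are continuous on `J`. -/
structure ContinuousData {n k : ℕ} (c : ℝ → Coeffs n k) (J : Set ℝ) : Prop where
  contA : ContinuousOn (fun t => (c t).A) J
  contB : ContinuousOn (fun t => (c t).B) J
  contC : ContinuousOn (fun t => (c t).C) J
  contD : ContinuousOn (fun t => (c t).D) J
  contL : ContinuousOn (fun t => (c t).L) J
  contQ : ContinuousOn (fun t => (c t).Q) J
  contR : ContinuousOn (fun t => (c t).R) J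

/-- `X` solves `Ẋ = φ(τ, X)` on `[s, t]` and takes positive definite values there. -/
def IsTrajectory {n k : ℕ} (c : ℝ → Coeffs n k) (s t : ℝ)
    (X : ℝ → Matrix (Fin n) (Fin n) ℝ) : Prop :=
  ∀ τ ∈ Icc s t, (X τ).PosDef ∧
    ∀ i j, HasDerivWithinAt (fun r => X r i j) ((c τ).phi (X τ) i j) (Icc s t) τ

/-- The graph of the (partially defined) flow `M_s^t` of the equation on the positive definite
matrices: the trajectory that starts from `G` at time `s` stays positive definite up to time `t`,
where it equals `P`. -/
def FlowsTo {n k : ℕ} (c : ℝ → Coeffs n k) (s t : ℝ) (G P : Matrix (Fin n) (Fin n) ℝ) : Prop :=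
  ∃ X : ℝ → Matrix (Fin n) (Fin n) ℝ, IsTrajectory c s t X ∧ X s = G ∧ X t = P

/-- The flow with data `c` on the time set `J` is non-expansive for `d`:
`d (M_s^t(G₁), M_s^t(G₂)) ≤ d (G₁, G₂)` whenever `s ≤ t` in `J` and both sides are defined. -/
def NonExpansive {n k : ℕ}
    (d : Matrix (Fin n) (Fin n) ℝ → Matrix (Fin n) (Fin n) ℝ → ℝ)
    (c : ℝ → Coeffs n k) (J : Set ℝ) : Prop :=
  ∀ s ∈ J, ∀ t ∈ J, s ≤ t → ∀ G₁ G₂ P₁ P₂ : Matrix (Fin n) (Fin n) ℝ,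
    FlowsTo c s t G₁ P₁ → FlowsTo c s t G₂ P₂ → d P₁ P₂ ≤ d G₁ G₂

end GRDE

/-! For the sup-norm the distance `d` is Thompson's metric: `d P Q ≤ α` means `P ≤ exp α • Q` and
`Q ≤ exp α • P` in the Loewner order. The quadratic form `v ⬝ᵥ φ(P) *ᵥ v` is the minimum over the
controls `u` of a Hamiltonian that is affine in `P` with a nonnegative constant term, the running
cost. So where `μ • X - Y` first degenerates, in a direction `v`, with `μ ≥ 1`, a control that is
optimal for `X` shows that `v ⬝ᵥ φ(Y) *ᵥ v ≤ μ * (v ⬝ᵥ φ(X) *ᵥ v)`, and the bound `Y ≤ μ • X`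
persists along the flow.

Conversely, there are constant data for which the equation reads `Ṗ = P j j • E i i`. Started at
`1` and at `diagonal (exp x)`, the two solutions have logarithmic distance vector tending to `x`
with its coordinate `i` overwritten by `x j`. A gauge `ν` with non-expansive flow thus does not
increase when one coordinate is copied over another; copying a coordinate of largest absolute
value everywhere gives `ν 1 * ‖x‖ ≤ ν x`, and the opposite inequality holds for every gauge.
-/

namespace GRDE

open Matrix

section Gauge

variable {n : ℕ} {ν : (Fin n → ℝ) → ℝ}

namespace IsSymmetricGauge

theorem map_abs (h : IsSymmetricGauge ν) (x : Fin n → ℝ) : ν |x| = ν x :=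
  (h.symmetric (Equiv.refl _) x).symm

theorem map_comp_perm (h : IsSymmetricGauge ν) (σ : Equiv.Perm (Fin n)) (x : Fin n → ℝ) :
    ν (x ∘ σ) = ν x := by
  rw [h.symmetric σ x, ← h.map_abs (x ∘ σ)]
  rfl

theorem map_zero (h : IsSymmetricGauge ν) : ν 0 = 0 := by
  have h_two := h.pos_homogeneous 2 0 two_pos
  rw [smul_zero] at h_two
  linarith

theorem map_smul (h : IsSymmetricGauge ν) (r : ℝ) (x : Fin n → ℝ) : ν (r • x) = |r| * ν x := by
  rcases eq_or_ne r 0 with rfl | hr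
  · simp [h.map_zero]
  · have h_abs : |(|r| • x)| = |r • x| := funext fun i => by simp
    rw [← h.pos_homogeneous |r| x (abs_pos.2 hr), ← h.map_abs (r • x), ← h_abs, h.map_abs]

/- A box is the convex hull of its vertices, and `ν` takes the value `ν y` at every vertex of the
box with half-sides `y i`. -/
theorem le_of_abs_le (h : IsSymmetricGauge ν) {x y : Fin n → ℝ} (hxy : |x| ≤ y) : ν x ≤ ν y := by
  have hx : x ∈ convexHull ℝ (univ.pi fun i => ({-y i, y i} : Set ℝ)) := by
    rw [convexHull_pi]
    intro i _
    have hi : |x i| ≤ y i := hxy i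
    change x i ∈ convexHull ℝ {-y i, y i}
    rw [convexHull_pair, segment_eq_Icc (by linarith [abs_nonneg (x i)])]
    exact abs_le.1 hi
  obtain ⟨z, hz, hxz⟩ := h.convex.exists_ge_of_mem_convexHull (subset_univ _) hx
  have hzy : |z| = |y| := funext fun i => by
    rcases hz i (mem_univ i) with hi | hi
    · simp [hi]
    · simp [mem_singleton_iff.1 hi]
  calc ν x ≤ ν z := hxz
    _ = ν y := by rw [← h.map_abs z, hzy, h.map_abs]

theorem nonneg (h : IsSymmetricGauge ν) (x : Fin n → ℝ) : 0 ≤ ν x := by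
  rw [← h.map_abs x, ← h.map_zero]
  exact h.le_of_abs_le (by simp)

theorem continuous (h : IsSymmetricGauge ν) : Continuous ν :=
  continuousOn_univ.1 (h.convex.continuousOn isOpen_univ)

theorem le_map_one_mul_norm (h : IsSymmetricGauge ν) (x : Fin n → ℝ) : ν x ≤ ν 1 * ‖x‖ := by
  calc ν x ≤ ν (‖x‖ • 1) := h.le_of_abs_le fun i => by simpa using norm_le_pi_norm x i
    _ = ν 1 * ‖x‖ := by rw [h.map_smul, abs_norm, mul_comm]

theorem map_const_le_of_update_le (hupdate : ∀ x i j, ν (Function.update x i (x j)) ≤ ν x)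
    (x : Fin n → ℝ) (j : Fin n) : ν (fun _ => x j) ≤ ν x := by
  suffices hpiece : ∀ s : Finset (Fin n), ν (s.piecewise (fun _ => x j) x) ≤ ν x by
    simpa using hpiece Finset.univ
  intro s
  induction s using Finset.induction_on with
  | empty => simp
  | insert i s _ ih =>
    have hj : s.piecewise (fun _ => x j) x j = x j := by by_cases hjs : j ∈ s <;> simp [hjs]
    calc ν ((insert i s).piecewise (fun _ => x j) x)
        = ν (Function.update (s.piecewise (fun _ => x j) x) i
            (s.piecewise (fun _ => x j) x j)) := by rw [Finset.piecewise_insert, hj]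
      _ ≤ ν (s.piecewise (fun _ => x j) x) := hupdate _ i j
      _ ≤ ν x := ih

theorem eq_mul_norm_of_update_le (h : IsSymmetricGauge ν)
    (hupdate : ∀ x i j, ν (Function.update x i (x j)) ≤ ν x) (x : Fin n → ℝ) :
    ν x = ν 1 * ‖x‖ := by
  refine le_antisymm (h.le_map_one_mul_norm x) ?_
  rcases isEmpty_or_nonempty (Fin n) with _ | _
  · simpa [Subsingleton.elim x 0] using h.nonneg 0
  obtain ⟨j, hj⟩ := Finite.exists_max fun i => ‖x i‖
  have hnorm : ‖x‖ = |x j| :=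
    le_antisymm ((pi_norm_le_iff_of_nonneg (abs_nonneg _)).2 hj) (norm_le_pi_norm x j)
  calc ν 1 * ‖x‖ = ν (x j • 1) := by rw [hnorm, h.map_smul, mul_comm]
    _ = ν (fun _ => x j) := by congr 1; ext; simp
    _ ≤ ν x := map_const_le_of_update_le hupdate x j

end IsSymmetricGauge

theorem euclideanGauge_eq_norm (x : Fin n → ℝ) : euclideanGauge x = ‖WithLp.toLp 2 x‖ := by
  simp [euclideanGauge, EuclideanSpace.norm_eq]

theorem isSymmetricGauge_euclideanGauge (n : ℕ) :
    IsSymmetricGauge (euclideanGauge : (Fin n → ℝ) → ℝ) where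
  convex := by
    have hnorm : (euclideanGauge : (Fin n → ℝ) → ℝ) =
        norm ∘ (WithLp.linearEquiv 2 ℝ (Fin n → ℝ)).symm := funext euclideanGauge_eq_norm
    rw [hnorm]
    exact convexOn_univ_norm.comp_linearMap
      (WithLp.linearEquiv 2 ℝ (Fin n → ℝ)).symm.toLinearMap
  pos_homogeneous r x hr := by
    simp only [euclideanGauge_eq_norm, WithLp.toLp_smul, norm_smul, Real.norm_of_nonneg hr.le]
  symmetric σ x := by
    simp only [euclideanGauge, sq_abs, Equiv.sum_comp σ fun i => x i ^ 2]

theorem euclideanGauge_ne_mul_norm (hn : 2 ≤ n) (a : ℝ) :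
    ¬ ∀ x : Fin n → ℝ, euclideanGauge x = a * ‖x‖ := by
  intro ha
  have : Nonempty (Fin n) := ⟨⟨0, by omega⟩⟩
  have ha_one : a = 1 := by
    simpa [euclideanGauge_eq_norm, Pi.norm_single] using (ha (Pi.single ⟨0, by omega⟩ 1)).symm
  have hn_one : √(n : ℝ) = 1 := by simpa [euclideanGauge, ha_one] using ha 1
  have : n = 1 := by exact_mod_cast Real.sqrt_eq_one.1 hn_one
  omega

end Gauge

section Diagonal

theorem cfc_diagonal {ι : Type*} [Fintype ι] [DecidableEq ι] (f : ℝ → ℝ) (d : ι → ℝ) :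
    cfc f (diagonal d) = diagonal (f ∘ d) := by
  let p := Lagrange.interpolate (Finset.univ.image d) id f
  have hp : ∀ i, p.eval (d i) = f (d i) := fun i =>
    Lagrange.eval_interpolate_at_node (v := id) f Function.injective_id.injOn
      (Finset.mem_image_of_mem d (Finset.mem_univ i))
  calc cfc f (diagonal d) = cfc p.eval (diagonal d) := cfc_congr fun x hx => by
        rw [spectrum_diagonal] at hx
        obtain ⟨i, rfl⟩ := hx
        exact (hp i).symm
    _ = Polynomial.aeval (diagonalAlgHom ℝ d) p := cfc_polynomial p _ (isHermitian_diagonal d)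
    _ = diagonal (f ∘ d) := by
        rw [Polynomial.aeval_algHom_apply, diagonalAlgHom_apply]
        congr 1
        funext i
        simp [hp]

theorem exists_perm_comp_eq_of_map_univ_eq {ι α : Type*} [Fintype ι] {f g : ι → α}
    (h : Finset.univ.val.map f = Finset.univ.val.map g) :
    ∃ σ : Equiv.Perm ι, g ∘ σ = f := by
  classical
  have hfiber : ∀ a, Nonempty ({i // f i = a} ≃ {i // g i = a}) := fun a => by
    refine ⟨Fintype.equivOfCardEq ?_⟩
    have hcount := congrArg (Multiset.count a) h
    rw [Multiset.count_map, Multiset.count_map] at hcount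
    simp only [Fintype.card_subtype, eq_comm (b := a)]
    exact hcount
  exact ⟨Equiv.ofFiberEquiv fun a => (hfiber a).some, funext fun i => Equiv.ofFiberEquiv_map _ i⟩

variable {n : ℕ} {ν : (Fin n → ℝ) → ℝ}

theorem IsSymmetricGauge.spectralFn_diagonal (h : IsSymmetricGauge ν) (d : Fin n → ℝ) :
    spectralFn ν (diagonal d) = ν d := by
  have hd : (diagonal d).IsHermitian := isHermitian_diagonal d
  have hroots : Finset.univ.val.map d = Finset.univ.val.map hd.eigenvalues := by
    have hprod : (diagonal d).charpoly =
        ((Finset.univ.val.map d).map fun a => Polynomial.X - Polynomial.C a).prod := by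
      rw [charpoly_diagonal, Finset.prod, Multiset.map_map]
      rfl
    rw [← Polynomial.roots_multiset_prod_X_sub_C (Finset.univ.val.map d), ← hprod]
    exact hd.roots_charpoly_eq_eigenvalues
  obtain ⟨σ, hσ⟩ := exists_perm_comp_eq_of_map_univ_eq hroots
  rw [spectralFn, dif_pos hd, ← h.map_comp_perm σ, hσ]

theorem invSqrt_diagonal {p : Fin n → ℝ} (hp : ∀ i, 0 < p i) :
    invSqrt (diagonal p) = diagonal fun i => (√(p i))⁻¹ := by
  rw [invSqrt, cfc_diagonal]
  refine inv_eq_left_inv ?_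
  rw [diagonal_mul_diagonal, ← diagonal_one]
  congr 1
  funext i
  exact inv_mul_cancel₀ (Real.sqrt_pos.2 (hp i)).ne'

theorem IsSymmetricGauge.finslerDist_diagonal (h : IsSymmetricGauge ν) {p : Fin n → ℝ}
    (hp : ∀ i, 0 < p i) (q : Fin n → ℝ) :
    finslerDist ν (diagonal p) (diagonal q) = ν fun i => Real.log (q i / p i) := by
  have hratio : ∀ i, (√(p i))⁻¹ * q i * (√(p i))⁻¹ = q i / p i := fun i => by
    rw [mul_right_comm, ← mul_inv, Real.mul_self_sqrt (hp i).le, inv_mul_eq_div]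
  simp only [finslerDist, invSqrt_diagonal hp, diagonal_mul_diagonal, hratio, matLog, cfc_diagonal,
    h.spectralFn_diagonal]
  rfl

end Diagonal

section Thompson

open scoped MatrixOrder

variable {n : ℕ} {P Q S V : Matrix (Fin n) (Fin n) ℝ} {α : ℝ}

theorem continuousOn_spectrum (f : ℝ → ℝ) (S : Matrix (Fin n) (Fin n) ℝ) :
    ContinuousOn f (spectrum ℝ S) :=
  (Matrix.finite_spectrum S).continuousOn f

theorem isHermitian_cfc (f : ℝ → ℝ) (S : Matrix (Fin n) (Fin n) ℝ) : (cfc f S).IsHermitian :=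
  cfc_predicate f S

theorem spectralFn_norm_le_iff (hS : S.IsHermitian) (hα : 0 ≤ α) :
    spectralFn (fun x => ‖x‖) S ≤ α ↔ ∀ x ∈ spectrum ℝ S, |x| ≤ α := by
  rw [spectralFn, dif_pos hS, pi_norm_le_iff_of_nonneg hα, hS.spectrum_real_eq_range_eigenvalues,
    forall_mem_range]
  rfl

theorem spectralFn_norm_matLog_le_iff (hS : S.PosDef) (hα : 0 ≤ α) :
    spectralFn (fun x => ‖x‖) (matLog S) ≤ α ↔
      Real.exp (-α) • 1 ≤ S ∧ S ≤ Real.exp α • 1 := by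
  have hS' : IsSelfAdjoint S := hS.1
  rw [matLog, spectralFn_norm_le_iff (isHermitian_cfc _ _) hα,
    cfc_map_spectrum Real.log S hS' (continuousOn_spectrum _ _), forall_mem_image,
    ← Algebra.algebraMap_eq_smul_one, ← Algebra.algebraMap_eq_smul_one,
    algebraMap_le_iff_le_spectrum hS', le_algebraMap_iff_spectrum_le hS', ← forall₂_and]
  refine forall₂_congr fun x hx => ?_
  have hx_pos : 0 < x := hS.isStrictlyPositive.spectrum_pos hx
  rw [abs_le, Real.le_log_iff_exp_le hx_pos, Real.log_le_iff_le_exp hx_pos]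

theorem cfc_sqrt_mul_self (hP : P.PosSemidef) : cfc Real.sqrt P * cfc Real.sqrt P = P := by
  have hP' : IsSelfAdjoint P := hP.1
  calc cfc Real.sqrt P * cfc Real.sqrt P
      = cfc (fun x => √x * √x) P :=
        (cfc_mul _ _ _ (continuousOn_spectrum _ _) (continuousOn_spectrum _ _)).symm
    _ = cfc (fun x => x) P :=
        cfc_congr fun x hx => Real.mul_self_sqrt (spectrum_nonneg_of_nonneg hP.nonneg hx)
    _ = P := cfc_id' ℝ P

theorem isHermitian_invSqrt (P : Matrix (Fin n) (Fin n) ℝ) : (invSqrt P).IsHermitian :=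
  (isHermitian_cfc _ _).inv

theorem invSqrt_mul_mul_invSqrt_self (hP : P.PosDef) : invSqrt P * P * invSqrt P = 1 := by
  have hroot := cfc_sqrt_mul_self hP.posSemidef
  have hunit : IsUnit (cfc Real.sqrt P).det :=
    (isUnit_iff_isUnit_det _).1 (isUnit_of_mul_isUnit_left (hroot ▸ hP.isUnit))
  calc invSqrt P * P * invSqrt P
      = invSqrt P * (cfc Real.sqrt P * cfc Real.sqrt P) * invSqrt P := by rw [hroot]
    _ = 1 := by
      rw [invSqrt, ← Matrix.mul_assoc, nonsing_inv_mul _ hunit, Matrix.one_mul,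
        mul_nonsing_inv _ hunit]

theorem isUnit_invSqrt (hP : P.PosDef) : IsUnit (invSqrt P) :=
  isUnit_of_mul_isUnit_right (invSqrt_mul_mul_invSqrt_self hP ▸ isUnit_one)

theorem conjugate_le_conjugate_iff (hV : V.IsHermitian) (hVu : IsUnit V) :
    V * P * V ≤ V * Q * V ↔ P ≤ Q := by
  rw [← sub_nonneg, ← sub_nonneg (b := P), ← hVu.star_left_conjugate_nonneg_iff (x := Q - P),
    star_eq_conjTranspose, hV.eq, Matrix.mul_sub, Matrix.sub_mul]

theorem finslerDist_norm_le_iff (hP : P.PosDef) (hQ : Q.PosDef) (hα : 0 ≤ α) :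
    finslerDist (fun x => ‖x‖) P Q ≤ α ↔ P ≤ Real.exp α • Q ∧ Q ≤ Real.exp α • P := by
  have hV := isHermitian_invSqrt P
  have hVu := isUnit_invSqrt hP
  have hVQV : (invSqrt P * Q * invSqrt P).PosDef := by
    simpa only [star_eq_conjTranspose, hV.eq] using
      (IsUnit.posDef_star_right_conjugate_iff hVu).2 hQ
  have hsmul : ∀ a : ℝ, a • 1 = invSqrt P * (a • P) * invSqrt P := fun a => by
    rw [mul_smul_comm, smul_mul_assoc, invSqrt_mul_mul_invSqrt_self hP]
  rw [finslerDist, spectralFn_norm_matLog_le_iff hVQV hα, hsmul, hsmul,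
    conjugate_le_conjugate_iff hV hVu, conjugate_le_conjugate_iff hV hVu, Real.exp_neg,
    inv_smul_le_iff_of_pos (Real.exp_pos α)]

theorem finslerDist_const_mul (a : ℝ) (ν : (Fin n → ℝ) → ℝ) (P Q : Matrix (Fin n) (Fin n) ℝ) :
    finslerDist (fun x => a * ν x) P Q = a * finslerDist ν P Q := by
  simp only [finslerDist, spectralFn]
  split_ifs <;> simp

theorem finslerDist_norm_nonneg (P Q : Matrix (Fin n) (Fin n) ℝ) :
    0 ≤ finslerDist (fun x => ‖x‖) P Q := by
  simp only [finslerDist, spectralFn]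
  split_ifs <;> simp

end Thompson

section Touching

variable {s t : ℝ}

theorem hasDerivWithinAt_nonpos_of_isMinOn {f : ℝ → ℝ} {f' : ℝ} (hst : s < t)
    (hf : HasDerivWithinAt f f' (Icc s t) t) (hmin : IsMinOn f (Icc s t) t) : f' ≤ 0 := by
  have hdir : s - t ∈ posTangentConeAt (Icc s t) t :=
    sub_mem_posTangentConeAt_of_segment_subset (by rw [segment_symm, segment_eq_Icc hst.le])
  have hprod : 0 ≤ (s - t) * f' := by
    simpa using hmin.localize.hasFDerivWithinAt_nonneg hf.hasFDerivWithinAt hdir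
  nlinarith

theorem pos_of_touching {E : Type*} [TopologicalSpace E] [CompactSpace E] {f f' : ℝ → E → ℝ}
    (hcont : ContinuousOn (Function.uncurry f) (Icc s t ×ˢ univ))
    (hderiv : ∀ τ ∈ Icc s t, ∀ x, HasDerivWithinAt (fun r => f r x) (f' τ x) (Icc s t) τ)
    (hs : ∀ x, 0 < f s x)
    (htouch : ∀ τ ∈ Icc s t, (∀ y, 0 ≤ f τ y) → ∀ x, f τ x = 0 → 0 < f' τ x) :
    ∀ τ ∈ Icc s t, ∀ x, 0 < f τ x := by
  by_contra! hbad
  obtain ⟨τ₁, hτ₁, x₁, hx₁⟩ := hbad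
  have hcompact : IsCompact (Icc s t ×ˢ univ ∩ Function.uncurry f ⁻¹' Iic 0) :=
    (isCompact_Icc.prod isCompact_univ).of_isClosed_subset
      (hcont.preimage_isClosed_of_isClosed (isClosed_Icc.prod isClosed_univ) isClosed_Iic)
      inter_subset_left
  obtain ⟨⟨τ, x⟩, ⟨⟨hτ, -⟩, hx⟩, hfirst⟩ :=
    hcompact.exists_isMinOn ⟨(τ₁, x₁), ⟨hτ₁, mem_univ _⟩, hx₁⟩ continuousOn_fst
  have hbefore : ∀ r ∈ Ico s τ, ∀ y, 0 < f r y := fun r hr y => by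
    by_contra! hy
    have hτr : τ ≤ r := hfirst (a := (r, y)) ⟨⟨⟨hr.1, hr.2.le.trans hτ.2⟩, mem_univ _⟩, hy⟩
    exact hr.2.not_ge hτr
  have hsτ : s < τ := hτ.1.lt_of_ne fun h => (hs x).not_ge (h ▸ hx)
  have hnonneg : ∀ y, 0 ≤ f τ y := fun y => by
    have hleft : Filter.Tendsto (fun r => f r y) (nhdsWithin τ (Iio τ)) (nhds (f τ y)) :=
      (hderiv τ hτ y).continuousWithinAt.mono_of_mem_nhdsWithin
        (Icc_mem_nhdsLT_of_mem ⟨hsτ, hτ.2⟩)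
    refine ge_of_tendsto hleft ?_
    filter_upwards [Ioo_mem_nhdsLT hsτ] with r hr
    exact (hbefore r ⟨hr.1.le, hr.2⟩ y).le
  have hzero : f τ x = 0 := le_antisymm hx (hnonneg x)
  have hmin : IsMinOn (fun r => f r x) (Icc s τ) τ := fun r hr => by
    change f τ x ≤ f r x
    rcases hr.2.eq_or_lt with rfl | hlt
    · exact le_rfl
    · exact hzero.trans_le (hbefore r ⟨hr.1, hlt⟩ x).le
  exact (htouch τ hτ hnonneg x hzero).not_ge
    (hasDerivWithinAt_nonpos_of_isMinOn hsτ ((hderiv τ hτ x).mono (Icc_subset_Icc_right hτ.2)) hmin)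

variable {ι : Type*} [Fintype ι]

theorem exists_unit_dotProduct_mulVec_eq {v : ι → ℝ} (hv : v ≠ 0) (M : Matrix ι ι ℝ) :
    ∃ u : Metric.sphere (0 : ι → ℝ) 1,
      v ⬝ᵥ M *ᵥ v = ‖v‖ ^ 2 * ((u : ι → ℝ) ⬝ᵥ M *ᵥ u) := by
  have hnorm : ‖v‖ ≠ 0 := norm_ne_zero_iff.2 hv
  refine ⟨⟨‖v‖⁻¹ • v, by simp [norm_smul, hnorm]⟩, ?_⟩
  simp only [mulVec_smul, smul_dotProduct, dotProduct_smul, smul_eq_mul]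
  field_simp

theorem posDef_iff_forall_unit {M : Matrix ι ι ℝ} (hM : M.IsHermitian) :
    M.PosDef ↔ ∀ u : Metric.sphere (0 : ι → ℝ) 1, 0 < (u : ι → ℝ) ⬝ᵥ M *ᵥ u := by
  refine ⟨fun h u => h.dotProduct_mulVec_pos (ne_zero_of_mem_unit_sphere u),
    fun h => .of_dotProduct_mulVec_pos hM fun v hv => ?_⟩
  obtain ⟨u, hu⟩ := exists_unit_dotProduct_mulVec_eq hv M
  rw [star_trivial, hu]
  exact mul_pos (pow_pos (norm_pos_iff.2 hv) 2) (h u)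

theorem posSemidef_iff_forall_unit {M : Matrix ι ι ℝ} (hM : M.IsHermitian) :
    M.PosSemidef ↔ ∀ u : Metric.sphere (0 : ι → ℝ) 1, 0 ≤ (u : ι → ℝ) ⬝ᵥ M *ᵥ u := by
  refine ⟨fun h u => h.dotProduct_mulVec_nonneg u,
    fun h => .of_dotProduct_mulVec_nonneg hM fun v => ?_⟩
  rcases eq_or_ne v 0 with rfl | hv
  · simp
  obtain ⟨u, hu⟩ := exists_unit_dotProduct_mulVec_eq hv M
  rw [star_trivial, hu]
  exact mul_nonneg (sq_nonneg _) (h u)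

theorem posDef_of_touching {Z Z' : ℝ → Matrix ι ι ℝ}
    (hZ : ∀ τ ∈ Icc s t, (Z τ).IsHermitian)
    (hderiv : ∀ τ ∈ Icc s t, ∀ i j, HasDerivWithinAt (fun r => Z r i j) (Z' τ i j) (Icc s t) τ)
    (hs : (Z s).PosDef)
    (htouch : ∀ τ ∈ Icc s t, (Z τ).PosSemidef → ∀ v ≠ 0, Z τ *ᵥ v = 0 → 0 < v ⬝ᵥ Z' τ *ᵥ v) :
    ∀ τ ∈ Icc s t, (Z τ).PosDef := by
  have hpos := pos_of_touching (s := s) (t := t)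
    (f := fun τ (u : Metric.sphere (0 : ι → ℝ) 1) => (u : ι → ℝ) ⬝ᵥ Z τ *ᵥ u)
    (f' := fun τ u => (u : ι → ℝ) ⬝ᵥ Z' τ *ᵥ u) ?_ ?_ ?_ ?_
  · exact fun τ hτ => (posDef_iff_forall_unit (hZ τ hτ)).2 (hpos τ hτ)
  · have hentry : ∀ i j, ContinuousOn
        (fun p : ℝ × Metric.sphere (0 : ι → ℝ) 1 => Z p.1 i j) (Icc s t ×ˢ univ) := fun i j =>
      ContinuousOn.comp (g := fun r => Z r i j) (fun τ hτ => (hderiv τ hτ i j).continuousWithinAt)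
        continuousOn_fst fun p hp => hp.1
    have hcoord : ∀ i, Continuous fun p : ℝ × Metric.sphere (0 : ι → ℝ) 1 => (p.2 : ι → ℝ) i :=
      fun i => (continuous_apply i).comp (continuous_subtype_val.comp continuous_snd)
    simp only [Function.uncurry_def, dotProduct, mulVec]
    exact continuousOn_finsetSum _ fun i _ => (hcoord i).continuousOn.mul
      (continuousOn_finsetSum _ fun j _ => (hentry i j).mul (hcoord j).continuousOn)
  · intro τ hτ u
    simp only [dotProduct, mulVec]
    exact .fun_sum fun i _ => (HasDerivWithinAt.fun_sum fun j _ =>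
      (hderiv τ hτ i j).mul_const _).const_mul _
  · exact fun u => hs.dotProduct_mulVec_pos (ne_zero_of_mem_unit_sphere u)
  · intro τ hτ hnonneg u hu
    have hpsd := (posSemidef_iff_forall_unit (hZ τ hτ)).2 hnonneg
    exact htouch τ hτ hpsd u (ne_zero_of_mem_unit_sphere u)
      ((hpsd.dotProduct_mulVec_zero_iff _).1 hu)

end Touching

section Hamiltonian

open scoped MatrixOrder

variable {n k : ℕ} {P X Y : Matrix (Fin n) (Fin n) ℝ}

theorem dotProduct_mulVec_le_smul {ι : Type*} [Fintype ι] {X Y : Matrix ι ι ℝ} {μ : ℝ}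
    (h : Y ≤ μ • X) (w : ι → ℝ) : w ⬝ᵥ Y *ᵥ w ≤ μ * (w ⬝ᵥ X *ᵥ w) := by
  simpa only [star_trivial, sub_mulVec, smul_mulVec, dotProduct_sub, dotProduct_smul, smul_eq_mul,
    sub_nonneg] using (Matrix.le_iff.1 h).dotProduct_mulVec_nonneg w

namespace Coeffs

variable (c : Coeffs n k)

/-- The quadratic running cost of the state `v` and the control `u`. -/
def cost (v : Fin n → ℝ) (u : Fin k → ℝ) : ℝ :=
  Sum.elim v u ⬝ᵥ fromBlocks c.Q c.Lᵀ c.L c.R *ᵥ Sum.elim v u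

/-- The Hamiltonian of the stochastic linear-quadratic control problem: the rate of change of the
value `v ⬝ᵥ P *ᵥ v` under the drift `A v + B u` and the diffusion `C v + D u`, plus the running
cost. It is affine in `P`. -/
def hamiltonian (P : Matrix (Fin n) (Fin n) ℝ) (v : Fin n → ℝ) (u : Fin k → ℝ) : ℝ :=
  2 * ((c.A *ᵥ v + c.B *ᵥ u) ⬝ᵥ P *ᵥ v) +
    (c.C *ᵥ v + c.D *ᵥ u) ⬝ᵥ P *ᵥ (c.C *ᵥ v + c.D *ᵥ u) + c.cost v u

/-- The coefficient of the part of the Hamiltonian that is quadratic in the state. -/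
def stateWeight (P : Matrix (Fin n) (Fin n) ℝ) : Matrix (Fin n) (Fin n) ℝ :=
  c.Aᵀ * P + P * c.A + c.Cᵀ * P * c.C + c.Q

/-- The coefficient of the part of the Hamiltonian that is bilinear in the control and the
state. -/
def crossWeight (P : Matrix (Fin n) (Fin n) ℝ) : Matrix (Fin k) (Fin n) ℝ :=
  c.Bᵀ * P + c.Dᵀ * P * c.C + c.L

/-- The coefficient of the part of the Hamiltonian that is quadratic in the control. -/
def controlWeight (P : Matrix (Fin n) (Fin n) ℝ) : Matrix (Fin k) (Fin k) ℝ :=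
  c.R + c.Dᵀ * P * c.D

theorem phi_eq_schurComplement (P : Matrix (Fin n) (Fin n) ℝ) :
    c.phi P =
      c.stateWeight P - (c.crossWeight P)ᵀ * (c.controlWeight P)⁻¹ * c.crossWeight P :=
  rfl

theorem hamiltonian_eq_fromBlocks (hP : P.IsHermitian) (v : Fin n → ℝ) (u : Fin k → ℝ) :
    c.hamiltonian P v u = Sum.elim v u ⬝ᵥ
      fromBlocks (c.stateWeight P) (c.crossWeight P)ᵀ (c.crossWeight P) (c.controlWeight P) *ᵥ
        Sum.elim v u := by
  have hPt : Pᵀ = P := by simpa using hP.eq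
  have hsymm : ∀ x y, x ⬝ᵥ P *ᵥ y = y ⬝ᵥ P *ᵥ x := fun x y => by
    rw [← dotProduct_transpose_mulVec, hPt]
  have htranspose : ∀ {m l : ℕ} (M : Matrix (Fin m) (Fin l) ℝ) x y,
      x ⬝ᵥ Mᵀ *ᵥ y = (M *ᵥ x) ⬝ᵥ y := fun M x y => by
    rw [dotProduct_transpose_mulVec, dotProduct_comm]
  simp only [hamiltonian, cost, fromBlocks_mulVec, Sum.elim_comp_inl, Sum.elim_comp_inr,
    sumElim_dotProduct_sumElim, dotProduct_add, dotProduct_transpose_mulVec _ v u]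
  simp only [stateWeight, crossWeight, controlWeight, dotProduct_add, add_dotProduct, mulVec_add,
    add_mulVec, ← mulVec_mulVec, htranspose]
  rw [hsymm v (c.A *ᵥ v), hsymm (c.C *ᵥ v) (c.D *ᵥ u)]
  ring

variable {c}

theorem Admissible.cost_nonneg (hc : c.Admissible) (v : Fin n → ℝ) (u : Fin k → ℝ) :
    0 ≤ c.cost v u :=
  hc.1.dotProduct_mulVec_nonneg (Sum.elim v u)

theorem Admissible.posDef_controlWeight (hc : c.Admissible) (hP : P.PosDef) :
    (c.controlWeight P).PosDef := by
  have hR : c.R.PosSemidef := hc.1.submatrix Sum.inr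
  have hD : (c.Dᵀ * P * c.D).PosSemidef := hP.posSemidef.conjTranspose_mul_mul_same c.D
  refine .of_dotProduct_mulVec_pos (hR.add hD).1 fun u hu => ?_
  have hform : star u ⬝ᵥ c.controlWeight P *ᵥ u =
      u ⬝ᵥ c.R *ᵥ u + (c.D *ᵥ u) ⬝ᵥ P *ᵥ (c.D *ᵥ u) := by
    simp only [controlWeight, star_trivial, add_mulVec, dotProduct_add, ← mulVec_mulVec]
    rw [dotProduct_transpose_mulVec, dotProduct_comm (c.D *ᵥ u)]
  rw [hform]
  by_cases hDu : c.D *ᵥ u = 0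
  · have hRu : u ⬝ᵥ c.R *ᵥ u ≠ 0 := fun h =>
      hu (hc.2 u ((hR.dotProduct_mulVec_zero_iff u).1 h) hDu)
    simpa [hDu] using (hR.dotProduct_mulVec_nonneg u).lt_of_ne' hRu
  · exact add_pos_of_nonneg_of_pos (hR.dotProduct_mulVec_nonneg u) (hP.dotProduct_mulVec_pos hDu)

theorem Admissible.hamiltonian_eq (hc : c.Admissible) (hP : P.PosDef) (v : Fin n → ℝ)
    (u : Fin k → ℝ) :
    c.hamiltonian P v u = v ⬝ᵥ c.phi P *ᵥ v +
      (((c.controlWeight P)⁻¹ * c.crossWeight P) *ᵥ v + u) ⬝ᵥ c.controlWeight P *ᵥ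
        (((c.controlWeight P)⁻¹ * c.crossWeight P) *ᵥ v + u) := by
  have hS := hc.posDef_controlWeight hP
  let _ := hS.isUnit.invertible
  have hschur := schur_complement_eq₂₂ (c.stateWeight P) (c.crossWeight P)ᵀ v u hS.1
  simp only [conjTranspose_eq_transpose_of_trivial, transpose_transpose, star_trivial,
    ← dotProduct_mulVec] at hschur
  rw [c.hamiltonian_eq_fromBlocks hP.1, hschur, add_comm, phi_eq_schurComplement]

theorem Admissible.phi_le_hamiltonian (hc : c.Admissible) (hP : P.PosDef) (v : Fin n → ℝ)
    (u : Fin k → ℝ) : v ⬝ᵥ c.phi P *ᵥ v ≤ c.hamiltonian P v u := by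
  rw [hc.hamiltonian_eq hP]
  exact le_add_of_nonneg_right
    ((hc.posDef_controlWeight hP).posSemidef.dotProduct_mulVec_nonneg _)

theorem Admissible.exists_hamiltonian_eq (hc : c.Admissible) (hP : P.PosDef) (v : Fin n → ℝ) :
    ∃ u, c.hamiltonian P v u = v ⬝ᵥ c.phi P *ᵥ v :=
  ⟨-(((c.controlWeight P)⁻¹ * c.crossWeight P) *ᵥ v), by rw [hc.hamiltonian_eq hP]; simp⟩

theorem Admissible.hamiltonian_le_mul (hc : c.Admissible) {μ : ℝ} (hμ : 1 ≤ μ)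
    (hYX : Y ≤ μ • X) {v : Fin n → ℝ} (hv : Y *ᵥ v = μ • X *ᵥ v) (u : Fin k → ℝ) :
    c.hamiltonian Y v u ≤ μ * c.hamiltonian X v u := by
  have hdiffusion := dotProduct_mulVec_le_smul hYX (c.C *ᵥ v + c.D *ᵥ u)
  have hcost : c.cost v u ≤ μ * c.cost v u := le_mul_of_one_le_left (hc.cost_nonneg v u) hμ
  rw [hamiltonian, hamiltonian, hv, dotProduct_smul, smul_eq_mul]
  linarith

theorem Admissible.phi_le_mul_phi (hc : c.Admissible) (hX : X.PosDef) (hY : Y.PosDef) {μ : ℝ}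
    (hμ : 1 ≤ μ) (hYX : Y ≤ μ • X) {v : Fin n → ℝ} (hv : Y *ᵥ v = μ • X *ᵥ v) :
    v ⬝ᵥ c.phi Y *ᵥ v ≤ μ * (v ⬝ᵥ c.phi X *ᵥ v) := by
  obtain ⟨u, hu⟩ := hc.exists_hamiltonian_eq hX v
  calc v ⬝ᵥ c.phi Y *ᵥ v ≤ c.hamiltonian Y v u := hc.phi_le_hamiltonian hY v u
    _ ≤ μ * c.hamiltonian X v u := hc.hamiltonian_le_mul hμ hYX hv u
    _ = μ * (v ⬝ᵥ c.phi X *ᵥ v) := by rw [hu]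

end Coeffs

end Hamiltonian

section Comparison

open scoped MatrixOrder

variable {n k : ℕ} {c : ℝ → Coeffs n k} {s t : ℝ} {X Y : ℝ → Matrix (Fin n) (Fin n) ℝ}

/- The growing factor makes the derivative of `m τ • X τ - Y τ` strictly positive at a touching
point. -/
theorem IsTrajectory.le_add_mul_smul (hc : ∀ τ ∈ Icc s t, (c τ).Admissible)
    (hX : IsTrajectory c s t X) (hY : IsTrajectory c s t Y) {μ ε : ℝ} (hμ : 1 ≤ μ) (hε : 0 < ε)
    (h0 : Y s ≤ μ • X s) {τ : ℝ} (hτ : τ ∈ Icc s t) : Y τ ≤ (μ + ε * (1 + (τ - s))) • X τ := by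
  set m : ℝ → ℝ := fun r => μ + ε * (1 + (r - s)) with hm
  have hm_one : ∀ r ∈ Icc s t, 1 ≤ m r := fun r hr =>
    le_add_of_le_of_nonneg hμ (mul_nonneg hε.le (by linarith [hr.1]))
  have hm_deriv : ∀ r, HasDerivAt m ε r := fun r =>
    (((((hasDerivAt_id r).sub_const s).const_add 1).const_mul ε).const_add μ).congr_deriv
      (mul_one ε)
  refine Matrix.le_iff.2 (posDef_of_touching (Z := fun r => m r • X r - Y r)
    (Z' := fun r => ε • X r + m r • (c r).phi (X r) - (c r).phi (Y r)) (fun r hr => ?_)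
    (fun r hr i j => ?_) ?_ (fun r hr hpsd v hv hZv => ?_) τ hτ).posSemidef
  · exact ((hX r hr).1.1.smul (by simp [IsSelfAdjoint])).sub (hY r hr).1.1
  · exact ((hm_deriv r).hasDerivWithinAt.mul ((hX r hr).2 i j)).sub ((hY r hr).2 i j)
  · have hinit : m s • X s - Y s = ε • X s + (μ • X s - Y s) := by
      simp only [hm, sub_self, add_zero, mul_one]
      module
    have hs : s ∈ Icc s t := left_mem_Icc.2 (hτ.1.trans hτ.2)
    simpa only [hinit] using ((hX s hs).1.smul hε).add_posSemidef (Matrix.le_iff.1 h0)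
  · have htouch : Y r *ᵥ v = m r • X r *ᵥ v := by
      rw [sub_mulVec, smul_mulVec, sub_eq_zero] at hZv
      exact hZv.symm
    have hphi := (hc r hr).phi_le_mul_phi (hX r hr).1 (hY r hr).1 (hm_one r hr)
      (Matrix.le_iff.2 hpsd) htouch
    have hstrict : 0 < ε * (v ⬝ᵥ X r *ᵥ v) := mul_pos hε ((hX r hr).1.dotProduct_mulVec_pos hv)
    simp only [sub_mulVec, add_mulVec, smul_mulVec, dotProduct_sub, dotProduct_add,
      dotProduct_smul, smul_eq_mul]
    linarith

theorem IsTrajectory.le_smul (hst : s ≤ t) (hc : ∀ τ ∈ Icc s t, (c τ).Admissible)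
    (hX : IsTrajectory c s t X) (hY : IsTrajectory c s t Y) {μ : ℝ} (hμ : 1 ≤ μ)
    (h0 : Y s ≤ μ • X s) : Y t ≤ μ • X t := by
  have ht : t ∈ Icc s t := right_mem_Icc.2 hst
  have hherm : (μ • X t - Y t).IsHermitian :=
    ((hX t ht).1.1.smul (by simp [IsSelfAdjoint])).sub (hY t ht).1.1
  refine Matrix.le_iff.2 (.of_dotProduct_mulVec_nonneg hherm fun v => ?_)
  have hlim : Filter.Tendsto (fun ε : ℝ => (μ + ε * (1 + (t - s))) * (v ⬝ᵥ X t *ᵥ v))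
      (nhdsWithin 0 (Ioi 0)) (nhds (μ * (v ⬝ᵥ X t *ᵥ v))) :=
    (Continuous.tendsto' (by fun_prop) _ _ (by simp)).mono_left nhdsWithin_le_nhds
  have hle : v ⬝ᵥ Y t *ᵥ v ≤ μ * (v ⬝ᵥ X t *ᵥ v) := by
    refine ge_of_tendsto hlim ?_
    filter_upwards [self_mem_nhdsWithin] with ε hε
    exact dotProduct_mulVec_le_smul (hX.le_add_mul_smul hc hY hμ hε h0 ht) v
  simpa [sub_mulVec, smul_mulVec] using hle

theorem FlowsTo.finslerDist_norm_le (hst : s ≤ t) (hc : ∀ τ ∈ Icc s t, (c τ).Admissible)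
    {G₁ G₂ P₁ P₂ : Matrix (Fin n) (Fin n) ℝ} (h₁ : FlowsTo c s t G₁ P₁)
    (h₂ : FlowsTo c s t G₂ P₂) :
    finslerDist (fun x => ‖x‖) P₁ P₂ ≤ finslerDist (fun x => ‖x‖) G₁ G₂ := by
  obtain ⟨X, hX, rfl, rfl⟩ := h₁
  obtain ⟨Y, hY, rfl, rfl⟩ := h₂
  have hs : s ∈ Icc s t := left_mem_Icc.2 hst
  have ht : t ∈ Icc s t := right_mem_Icc.2 hst
  have hdist := finslerDist_norm_nonneg (X s) (Y s)
  have hμ := Real.one_le_exp hdist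
  obtain ⟨hXY, hYX⟩ := (finslerDist_norm_le_iff (hX s hs).1 (hY s hs).1 hdist).1 le_rfl
  exact (finslerDist_norm_le_iff (hX t ht).1 (hY t ht).1 hdist).2
    ⟨hY.le_smul hst hc hX hμ hXY, hX.le_smul hst hc hY hμ hYX⟩

end Comparison

section CopyCoordinate

variable {n : ℕ} (k : ℕ)

/-- Data for which the equation reads `Ṗ = P j j • E i i`, so that on diagonal matrices it moves
only the `i`-th entry, towards a multiple of the `j`-th one. -/
def copyCoeffs (i j : Fin n) : Coeffs n k where
  A := 0
  B := 0
  C := single j i 1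
  D := 0
  L := 0
  Q := 0
  R := 1

theorem admissible_copyCoeffs (i j : Fin n) : (copyCoeffs k i j).Admissible := by
  refine ⟨?_, fun u hu _ => by simpa [copyCoeffs] using hu⟩
  have hblocks : fromBlocks (0 : Matrix (Fin n) (Fin n) ℝ) 0 0 (1 : Matrix (Fin k) (Fin k) ℝ) =
      diagonal (Sum.elim 0 1) := by
    rw [← fromBlocks_diagonal]
    congr
    exact diagonal_zero.symm
  simp only [copyCoeffs, transpose_zero, hblocks]
  exact .diagonal (Sum.rec (fun _ => le_rfl) fun _ => zero_le_one)

variable {k}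

theorem phi_copyCoeffs_diagonal (i j : Fin n) (p : Fin n → ℝ) :
    (copyCoeffs k i j).phi (diagonal p) = diagonal (Pi.single i (p j)) := by
  simp [Coeffs.phi, copyCoeffs, diagonal_single]

theorem update_add_mul_pos {ι : Type*} [DecidableEq ι] {p : ι → ℝ} (hp : ∀ l, 0 < p l) {t : ℝ}
    (ht : 0 ≤ t) (i j l : ι) : 0 < Function.update p i (p i + t * p j) l := by
  rcases eq_or_ne l i with rfl | hl
  · simpa using add_pos_of_pos_of_nonneg (hp l) (mul_nonneg ht (hp j).le)
  · simpa [hl] using hp l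

theorem flowsTo_copyCoeffs {i j : Fin n} (hij : i ≠ j) {p : Fin n → ℝ} (hp : ∀ l, 0 < p l)
    (t : ℝ) :
    FlowsTo (fun _ => copyCoeffs k i j) 0 t (diagonal p)
      (diagonal (Function.update p i (p i + t * p j))) := by
  refine ⟨fun r => diagonal (Function.update p i (p i + r * p j)),
    fun r hr => ⟨.diagonal (update_add_mul_pos hp hr.1 i j), fun a b => ?_⟩, by simp, rfl⟩
  rw [phi_copyCoeffs_diagonal, Function.update_of_ne hij.symm]
  refine HasDerivAt.hasDerivWithinAt ?_
  rcases eq_or_ne a b with rfl | hab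
  · rcases eq_or_ne a i with rfl | ha
    · simpa using ((hasDerivAt_id r).mul_const (p j)).const_add (p a)
    · simpa [ha] using hasDerivAt_const r (p a)
  · simpa [hab] using hasDerivAt_const r (0 : ℝ)

theorem tendsto_add_mul_div_add_mul_atTop (a b : ℝ) {c d : ℝ} (hd : d ≠ 0) :
    Filter.Tendsto (fun t => (a + t * c) / (b + t * d)) Filter.atTop (nhds (c / d)) := by
  have hzero : ∀ e : ℝ, Filter.Tendsto (fun t : ℝ => e / t) Filter.atTop (nhds 0) := fun e =>
    Filter.tendsto_id.const_div_atTop e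
  have hlim := ((hzero a).add_const c).div ((hzero b).add_const d) (by simpa using hd)
  simp only [zero_add] at hlim
  refine hlim.congr' ?_
  filter_upwards [Filter.eventually_ne_atTop 0] with t ht
  simp only [Pi.div_apply]
  rw [← mul_div_mul_left _ _ ht, mul_add, mul_add, mul_div_cancel₀ _ ht, mul_div_cancel₀ _ ht]

theorem IsSymmetricGauge.map_update_le_of_nonExpansive {ν : (Fin n → ℝ) → ℝ}
    (h : IsSymmetricGauge ν)
    (hne : ∀ c : Coeffs n k, c.Admissible → NonExpansive (finslerDist ν) (fun _ => c) (Ici 0))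
    (x : Fin n → ℝ) (i j : Fin n) : ν (Function.update x i (x j)) ≤ ν x := by
  rcases eq_or_ne i j with rfl | hij
  · simp
  let w : ℝ → ℝ := fun t => Real.log ((Real.exp (x i) + t * Real.exp (x j)) / (1 + t * 1))
  have hw : Filter.Tendsto w Filter.atTop (nhds (x j)) := by
    have hlim := (tendsto_add_mul_div_add_mul_atTop (Real.exp (x i)) 1 (c := Real.exp (x j))
      one_ne_zero).log (by simp)
    simpa [w] using hlim
  have hle : ∀ t : ℝ, 0 ≤ t → ν (Function.update x i (w t)) ≤ ν x := fun t ht => by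
    have hone : ∀ l, 0 < (1 : Fin n → ℝ) l := fun _ => one_pos
    have hflow := hne _ (admissible_copyCoeffs k i j) 0 self_mem_Ici t ht ht _ _ _ _
      (flowsTo_copyCoeffs hij hone t) (flowsTo_copyCoeffs hij (fun l => Real.exp_pos (x l)) t)
    rw [h.finslerDist_diagonal (update_add_mul_pos hone ht i j), h.finslerDist_diagonal hone]
      at hflow
    convert hflow using 2
    · funext l
      rcases eq_or_ne l i with rfl | hl
      · simp [w]
      · simp [hl]
    · simp
  exact le_of_tendsto ((h.continuous.tendsto _).comp (tendsto_const_nhds.update i hw))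
    (Filter.eventually_atTop.2 ⟨0, hle⟩)

theorem IsSymmetricGauge.eq_mul_norm_of_nonExpansive {ν : (Fin n → ℝ) → ℝ}
    (h : IsSymmetricGauge ν)
    (hne : ∀ c : Coeffs n k, c.Admissible → NonExpansive (finslerDist ν) (fun _ => c) (Ici 0))
    (x : Fin n → ℝ) : ν x = ν 1 * ‖x‖ :=
  h.eq_mul_norm_of_update_le (h.map_update_le_of_nonExpansive hne) x

end CopyCoordinate

end GRDE

theorem mainTheorem3_general (n k : ℕ) :
    (∀ ν : (Fin n → ℝ) → ℝ, GRDE.IsSymmetricGauge ν →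
      List.TFAE [
        ∀ J : Set ℝ, J.OrdConnected → ∀ c : ℝ → GRDE.Coeffs n k, (∀ t ∈ J, (c t).Admissible) →
          GRDE.NonExpansive (GRDE.finslerDist ν) c J,
        ∀ T : ℝ, 0 < T → ∀ c : ℝ → GRDE.Coeffs n k,
          GRDE.ContinuousData c (Set.Icc 0 T) → (∀ t ∈ Set.Icc 0 T, (c t).Admissible) →
            GRDE.NonExpansive (GRDE.finslerDist ν) c (Set.Icc 0 T),
        ∀ c : GRDE.Coeffs n k, c.Admissible →
          GRDE.NonExpansive (GRDE.finslerDist ν) (fun _ => c) (Set.Ici 0),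
        ∃ a : ℝ, 0 ≤ a ∧ ∀ x : Fin n → ℝ, ν x = a * ‖x‖]) ∧
    (2 ≤ n → ∃ c : GRDE.Coeffs n k, c.Admissible ∧
      ¬ GRDE.NonExpansive (GRDE.finslerDist GRDE.euclideanGauge) (fun _ => c) (Set.Ici 0)) := by
  refine ⟨fun ν hν => ?_, fun hn => ?_⟩
  · tfae_have 1 → 2 := fun h T _ c _ hc => h (Set.Icc 0 T) Set.ordConnected_Icc c hc
    tfae_have 2 → 3 := fun h c hc s hs t ht hst =>
      h (t + 1) (add_pos_of_nonneg_of_pos ht one_pos) (fun _ => c)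
        (by constructor <;> exact continuousOn_const) (fun _ _ => hc)
        s ⟨hs, by linarith⟩ t ⟨ht, by linarith⟩ hst
    tfae_have 3 → 4 := fun h => ⟨ν 1, hν.nonneg 1, hν.eq_mul_norm_of_nonExpansive h⟩
    tfae_have 4 → 1 := by
      rintro ⟨a, ha, hνa⟩ J hJ c hc s hs t ht hst G₁ G₂ P₁ P₂ h₁ h₂
      obtain rfl : ν = fun x => a * ‖x‖ := funext hνa
      rw [GRDE.finslerDist_const_mul, GRDE.finslerDist_const_mul]
      exact mul_le_mul_of_nonneg_left
        (h₁.finslerDist_norm_le hst (fun τ hτ => hc τ (hJ.out hs ht hτ)) h₂) ha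
    tfae_finish
  · by_contra! h
    exact GRDE.euclideanGauge_ne_mul_norm hn _
      ((GRDE.isSymmetricGauge_euclideanGauge n).eq_mul_norm_of_nonExpansive (k := k) h)

/-- The norm `‖x‖` on `Fin n → ℝ` is the sup-norm. -/
theorem mainTheorem3 (n k : ℕ) :
    (∀ ν : (Fin n → ℝ) → ℝ, GRDE.IsSymmetricGauge ν →
      List.TFAE [
        -- time-dependent data on a bounded time interval
        ∀ T : ℝ, 0 < T → ∀ c : ℝ → GRDE.Coeffs n k,
          GRDE.ContinuousData c (Set.Icc 0 T) → (∀ t ∈ Set.Icc 0 T, (c t).Admissible) →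
            GRDE.NonExpansive (GRDE.finslerDist ν) c (Set.Icc 0 T),
        -- constant data
        ∀ c : GRDE.Coeffs n k, c.Admissible →
          GRDE.NonExpansive (GRDE.finslerDist ν) (fun _ => c) (Set.Ici 0),
        ∃ a : ℝ, 0 ≤ a ∧ ∀ x : Fin n → ℝ, ν x = a * ‖x‖]) ∧
    (2 ≤ n → ∃ c : GRDE.Coeffs n k, c.Admissible ∧
      ¬ GRDE.NonExpansive (GRDE.finslerDist GRDE.euclideanGauge) (fun _ => c) (Set.Ici 0)) :=
  ⟨fun ν hν => (List.tfae_cons_cons.1 ((mainTheorem3_general n k).1 ν hν)).2,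
    (mainTheorem3_general n k).2⟩
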